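/- **Setting.** Let $H=(V,E)$ be a finite hypergraph with $n$ vertices, maximum degree $\Delta$ (the degree of a vertex is the number of edges containing it) and rank $r$ (the largest size of an edge). In the deterministic LOCAL model each vertex has a unique identifier from $\{0,\dots,n^c\}$, where $c$ is a fixed constant, and initially knows its identifier, the edges containing it (as sets of identifiers), and the numbers $n,\Delta,r,\alpha,\beta$; in each synchronous round it performs an arbitrary computation and exchanges messages of arbitrary size with all its neighbours, i.e. the vertices with which it shares an edge. For integers $0\le\alpha\le\beta$, an *$(\alpha,\beta)$-independent set* is a set $S\subseteq V$ such that $|e\cap S|\le\beta$ for every $e\in E$, and every $v\in V$ is in $S$ or lies in an edge $e$ with $|e\cap S|\ge\alpha$. Put $\delta=\beta-\alpha+1$ and assume $\delta\le r$ (this holds in particular if $1\le\alpha\le\beta<r$). **Algorithm.** (1) List the vertices of each edge $e$ by increasing identifier and cut the list into $\delta$ consecutive (possibly empty) parts $e_1,\dots,e_\delta$ of at most $\lceil r/\delta\rceil$ vertices each. Let $H'$ be the hypergraph on $V$ whose edges are all these parts, and $G'$ its underlying graph, in which two distinct vertices are adjacent if they lie in a common part. (2) For a number of rounds determined by $n$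 and $\lfloor\Delta r/\delta\rfloor$, run a LOCAL colouring subroutine on $H'$ that computes a proper colouring $\Psi$ of $G'$ with colours $1,\dots,\lfloor\Delta r/\delta\rfloor+1$. (3) For $i=1,2,\dots$, in one round each, all vertices $v$ with $\Psi(v)=i$ simultaneously decide: $v$ joins $S$ (initially empty) if and only if every edge containing $v$ contains fewer than $\alpha$ vertices that joined in earlier rounds; $v$ sends its decision to all its neighbours. **Theorem.** For every $c$ there are a colouring subroutine as in (2) and a constant $C$, depending only on $c$, such that for all $H$, identifiers, $\alpha,\beta$ as above, the subroutine properly colours $G'$ with colours $1,\dots,\lfloor\Delta r/\delta\rfloor+1$, and the algorithm with this subroutine terminates at all vertices after at most $C\,(\Delta r/\delta+\log^* n)$ rounds and outputs an $(\alpha,\beta)$-independent set $S$. Here $\log^* n$ is the number of times $\log_2$ must be applied to $n$ to reach a value at most $1$. -/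

import Mathlib

open scoped Hypergraph

noncomputable section

/-! ### Hypergraphs -/

namespace Hypergraph

variable {V : Type*}

/-- The rank of a hypergraph: the largest number of vertices in an edge. -/
def rank (H : Hypergraph V) : ℕ := sSup (Set.ncard '' E(H))

/-- The degree of a vertex: the number of edges that contain it. -/
def degree (H : Hypergraph V) (v : V) : ℕ := {e ∈ E(H) | v ∈ e}.ncard

/-- The maximum degree of a vertex. -/
def maxDegree (H : Hypergraph V) : ℕ := sSup (H.degree '' V(H))

/-- The underlying graph: every edge is replaced by a clique on its vertices. -/
def underlyingGraph (H : Hypergraph V) : SimpleGraph V where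
  Adj u v := u ≠ v ∧ H.Adj u v
  symm := ⟨fun _ _ h => ⟨h.1.symm, h.2.symm⟩⟩
  loopless := ⟨fun _ h => h.1 rfl⟩

/-- `S` is an `(α, β)`-independent set of `H`. -/
structure IsIndependentSet (H : Hypergraph V) (α β : ℕ) (S : Set V) : Prop where
  subset : S ⊆ V(H)
  le_of_edge : ∀ e ∈ E(H), (e ∩ S).ncard ≤ β
  mem_or : ∀ v ∈ V(H), v ∈ S ∨ ∃ e ∈ E(H), v ∈ e ∧ α ≤ (e ∩ S).ncard

end Hypergraph

/-- The `i`-th part (`i = 0, 1, …`) of the set `e` when its elements are listed by increasing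
identifier `f` and the list is cut into consecutive blocks of length `b`. -/
def edgePart {X : Type*} (f : X → ℕ) (b : ℕ) (e : Set X) (i : ℕ) : Set X :=
  {x ∈ e | {y ∈ e | f y < f x}.ncard / b = i}

/-- The block length `⌈r / δ⌉`. -/
def blockLength (r δ : ℕ) : ℕ := (r + δ - 1) / δ

/-- The hypergraph obtained from `H` when each edge is replaced by its `δ` parts. -/
def Hypergraph.split {V : Type*} (H : Hypergraph V) (ident : V → ℕ) (δ : ℕ) : Hypergraph V where
  vertexSet := V(H)
  edgeSet := {p | ∃ e ∈ E(H), ∃ i < δ, p = edgePart ident (blockLength H.rank δ) e i}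
  subset_vertexSet_of_mem_edgeSet' := by
    rintro _ ⟨e, he, i, -, rfl⟩ x hx
    exact he.subset_vertexSet hx.1

/-! ### The LOCAL model -/

/-- What a vertex knows at the start: its own identifier, and the edges that it belongs to,
each given as the set of the identifiers of its vertices. -/
structure LocalView where
  ident : ℕ
  edges : Set (Set ℕ)

/-- The identifiers of the neighbours of the vertex. -/
def LocalView.neighbors (w : LocalView) : Set ℕ := {m | m ≠ w.ident ∧ ∃ e ∈ w.edges, m ∈ e}

/-- The local view of `v` in the hypergraph `H` with identifiers `ident`. -/
def Hypergraph.localView {V : Type*} (H : Hypergraph V) (ident : V → ℕ) (v : V) : LocalView where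
  ident := ident v
  edges := Set.image ident '' {e ∈ E(H) | v ∈ e}

/-- A deterministic algorithm in the LOCAL model. `P` is the type of the global parameters that are
known to all vertices. In every round each vertex sends to each neighbour a message of arbitrary
size (`send s m` is the message for the neighbour with identifier `m`) and updates its state
according to the messages it receives (the inbox assigns to the identifier of each neighbour the
message received from it, and `none` to every other number). A vertex in state `s` with
`output s = some o` has irrevocably decided on the output `o`. -/
structure LocalAlgorithm (P Out : Type) where
  State : Type
  Msg : Type
  init : P → LocalView → State
  send : State → ℕ → Msg
  receive : State → (ℕ → Option Msg) → State
  output : State → Option Out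
  output_receive : ∀ s inbox o, output s = some o → output (receive s inbox) = some o

namespace LocalAlgorithm

variable {P Out : Type} {V : Type*}

open Classical in
/-- The messages that `v` receives when the current states of the vertices are `σ`. -/
def inbox (A : LocalAlgorithm P Out) (H : Hypergraph V) (ident : V → ℕ) (σ : V → A.State) (v : V) :
    ℕ → Option A.Msg := fun m =>
  if h : ∃ u, H.underlyingGraph.Adj v u ∧ ident u = m then
    some (A.send (σ h.choose) (ident v)) else none

/-- The states of the vertices after `t` rounds of the algorithm on `H` with parameters `p`. -/
def run (A : LocalAlgorithm P Out) (H : Hypergraph V) (ident : V → ℕ) (p : P) : ℕ → V → A.State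
  | 0 => fun v => A.init p (H.localView ident v)
  | t + 1 => fun v =>
      A.receive (A.run H ident p t v) (A.inbox H ident (A.run H ident p t) v)

/-- After `T` rounds on `H` with parameters `p`, all vertices have decided on their outputs, and
the output of each vertex `v` is `o v`. -/
def Computes (A : LocalAlgorithm P Out) (H : Hypergraph V) (ident : V → ℕ) (p : P) (T : ℕ)
    (o : V → Out) : Prop :=
  ∀ v ∈ V(H), A.output (A.run H ident p T v) = some (o v)

end LocalAlgorithm

/-! ### The algorithm -/

/-- The parameters known to all vertices: the number `n` of vertices, the maximum degree `Δ`, the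
rank `r`, and `α`, `β`. -/
structure ISParams where
  n : ℕ
  Δ : ℕ
  r : ℕ
  α : ℕ
  β : ℕ

/-- `δ = β - α + 1`. -/
def ISParams.δ (p : ISParams) : ℕ := p.β - p.α + 1

/-- The parameters passed to the colouring subroutine: the number of vertices, and the bound
`⌊Δ r / δ⌋` on the degree of the graph that has to be coloured. -/
def ISParams.colorParams (p : ISParams) : ℕ × ℕ := (p.n, p.Δ * p.r / p.δ)

/-- The local view in the split hypergraph, as computed by the vertex from its view in `H`. -/
def LocalView.split (w : LocalView) (r δ : ℕ) : LocalView where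
  ident := w.ident
  edges := {q | w.ident ∈ q ∧ ∃ e ∈ w.edges, ∃ i < δ, q = edgePart (fun m => m) (blockLength r δ) e i}

/-- The state of a vertex: the parameters, its local view, the number of rounds that have passed,
the state of the colouring subroutine, the set of (identifiers of) neighbours that are known to be
in the independent set, and the decision. -/
structure ISState (S : Type) where
  params : ISParams
  view : LocalView
  clock : ℕ
  colState : S
  joined : Set ℕ
  decision : Option Bool

open Classical in
/-- The algorithm. The first `t` rounds (`t` is determined by the parameters) run the colouring
subroutine `col` on the hypergraph in which every edge is split into `δ` parts. Afterwards, the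
colour classes `1, 2, …` are activated one per round. An active vertex joins the independent set if
each of its edges contains fewer than `α` members, and it broadcasts its decision. -/
def edgePartitionIS (col : LocalAlgorithm (ℕ × ℕ) ℕ) (tcol : ℕ × ℕ → ℕ) :
    LocalAlgorithm ISParams Bool :=
  let coloring : ISState col.State → Prop := fun s => s.clock < tcol s.params.colorParams
  let active : ISState col.State → Prop := fun s =>
    col.output s.colState = some (s.clock - tcol s.params.colorParams + 1)
  let canJoin : ISState col.State → Prop := fun s =>
    ∀ e ∈ s.view.edges, (e ∩ s.joined).ncard < s.params.α
  { State := ISState col.State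
    Msg := col.Msg ⊕ Bool
    init := fun p w =>
      { params := p
        view := w
        clock := 0
        colState := col.init p.colorParams (w.split p.r p.δ)
        joined := ∅
        decision := none }
    send := fun s m =>
      if coloring s then Sum.inl (col.send s.colState m)
      else Sum.inr (decide (active s ∧ canJoin s))
    receive := fun s inbox =>
      if coloring s then
        { s with
          clock := s.clock + 1
          colState := col.receive s.colState fun m =>
            if m ∈ (s.view.split s.params.r s.params.δ).neighbors then
              (inbox m).bind Sum.getLeft? else none }
      else
        { s with
          clock := s.clock + 1
          joined := s.joined ∪ {m | inbox m = some (Sum.inr true)}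
          decision := s.decision.or (if active s then some (decide (canJoin s)) else none) }
    output := fun s => s.decision
    output_receive := by
      intro s inbox o h
      split_ifs <;> simp [h] }

/-- The iterated logarithm to base 2: how often the logarithm has to be applied to `n` until the
value is at most 1. -/
def logStar (n : ℕ) : ℕ := sInf {k : ℕ | (Real.logb 2)^[k] n ≤ 1}

end

/-! Selection. A colour class of `G'` meets each of the `δ` parts of an edge `e` in at most one
vertex, so it meets `e` in at most `δ` vertices (`ncard_color_class_le`). Consider the last class
that adds members to `e`. A vertex joining then certifies that `e` had at most `α - 1` members
before, hence at most `α - 1 + δ = β` at the end. A vertex that does not join has an edge with at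
least `α` members, and members never leave (`isIndependentSet_joinedSet`).

Time. Put `k = ⌊Δ r / δ⌋`. Since `(⌈r / δ⌉ - 1) δ ≤ r`, the graph `G'` has degrees at most `k`
(`split_degreeBound`). It remains to reach `k + 1` colours in `O(k + log* n)` rounds, for `k ≥ 1`.
Linial's reduction takes `2 ^ L` colours to `4 L ^ 4`, which lowers a tower of twos by one level per
round; after `log* n` rounds the identifiers have become `2 ^ O(k)` colours, and two more reductions
leave `q ^ 2` with a prime `q = O(k)`. The additive group algorithm reaches `q` colours in `q`
rounds (`Reduces.additive`), and the surplus is removed one colour per round. `exists_reduces` adds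
this up.

All these rounds have the same form: the new colour is a function of the old one and of the set of
neighbouring colours. `Reduces` fixes the functions before the graph, so vertices can derive them
from `n` and `k`. Two simulation invariants, `edgePartitionIS_run_coloring` and
`edgePartitionIS_run_selection`, transfer the combinatorics to the LOCAL algorithm. -/

noncomputable section

universe u

/-! ### Locally iterative colouring -/

section LocallyIterative

variable {V : Type*}

/-- One synchronous round of recolouring: each vertex computes its new colour from its own colour
and the set of the colours of its neighbours. -/
def recolor (G : SimpleGraph V) (f : ℕ → Set ℕ → ℕ) (φ : V → ℕ) : V → ℕ :=
  fun v => f (φ v) (φ '' G.neighborSet v)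

/-- Successive rounds of recolouring. -/
def recolorList (G : SimpleGraph V) (l : List (ℕ → Set ℕ → ℕ)) (φ : V → ℕ) : V → ℕ :=
  l.foldl (fun ψ f => recolor G f ψ) φ

/-- `φ` is a proper colouring of `G` whose values on `W` belong to `P`. -/
structure IsProperOn (G : SimpleGraph V) (W : Set V) (P : Set ℕ) (φ : V → ℕ) : Prop where
  mem : ∀ v ∈ W, φ v ∈ P
  ne : ∀ u v, G.Adj u v → φ u ≠ φ v

/-- All edges of `G` lie in `W` and all degrees are at most `k`. -/
structure DegreeBound (G : SimpleGraph V) (W : Set V) (k : ℕ) : Prop where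
  left_mem : ∀ u v, G.Adj u v → u ∈ W
  finite : ∀ v, (G.neighborSet v).Finite
  ncard_le : ∀ v, (G.neighborSet v).ncard ≤ k

end LocallyIterative

/-- Some `T` rounds of recolouring turn every proper colouring with colours from `P` of any graph
with degrees at most `k` into a proper colouring with colours from `Q`. -/
def Reduces (k T : ℕ) (P Q : Set ℕ) : Prop :=
  ∃ l : List (ℕ → Set ℕ → ℕ), l.length = T ∧
    ∀ (V : Type u) (G : SimpleGraph V) (W : Set V), DegreeBound G W k →
      ∀ φ : V → ℕ, IsProperOn G W P φ → IsProperOn G W Q (recolorList G l φ)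

namespace Reduces

variable {k T T₁ T₂ : ℕ} {P P' Q Q' R : Set ℕ}

theorem refl : Reduces.{u} k 0 P P := ⟨[], rfl, fun _ _ _ _ _ h => h⟩

theorem trans (h₁ : Reduces.{u} k T₁ P Q) (h₂ : Reduces.{u} k T₂ Q R) :
    Reduces.{u} k (T₁ + T₂) P R := by
  obtain ⟨l₁, rfl, h₁⟩ := h₁
  obtain ⟨l₂, rfl, h₂⟩ := h₂
  refine ⟨l₁ ++ l₂, by simp, fun V G W hG φ hφ => ?_⟩
  rw [recolorList, List.foldl_append]
  exact h₂ V G W hG _ (h₁ V G W hG φ hφ)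

theorem mono (h : Reduces.{u} k T P Q) (hP : P' ⊆ P) (hQ : Q ⊆ Q') : Reduces.{u} k T P' Q' := by
  obtain ⟨l, hl, h⟩ := h
  refine ⟨l, hl, fun V G W hG φ hφ => ?_⟩
  have := h V G W hG φ ⟨fun v hv => hP (hφ.mem v hv), hφ.ne⟩
  exact ⟨fun v hv => hQ (this.mem v hv), this.ne⟩

end Reduces

/-- `N` is a possible set of the colours of the neighbours of a vertex of colour `c`. -/
structure IsNeighborColors (k : ℕ) (P : Set ℕ) (c : ℕ) (N : Set ℕ) : Prop where
  mem : c ∈ P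
  subset : N ⊆ P
  notMem : c ∉ N
  finite : N.Finite
  ncard_le : N.ncard ≤ k

theorem IsProperOn.isNeighborColors {V : Type*} {G : SimpleGraph V} {W : Set V} {k : ℕ}
    {P : Set ℕ} {φ : V → ℕ} (hG : DegreeBound G W k) (hφ : IsProperOn G W P φ) {v : V}
    (hv : v ∈ W) : IsNeighborColors k P (φ v) (φ '' G.neighborSet v) where
  mem := hφ.mem v hv
  subset := by
    rintro _ ⟨u, hu, rfl⟩
    exact hφ.mem u (hG.left_mem u v (G.adj_symm hu))
  notMem := by
    rintro ⟨u, hu, h⟩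
    exact hφ.ne v u hu h.symm
  finite := (hG.finite v).image φ
  ncard_le := (Set.ncard_image_le (hG.finite v)).trans (hG.ncard_le v)

/-- Only what two adjacent vertices see matters, so each reduction below can be checked on abstract
pairs of a colour and a neighbour set, without a graph. -/
theorem IsProperOn.recolor {V : Type*} {G : SimpleGraph V} {W : Set V} {k : ℕ}
    {P Q : Set ℕ} {φ : V → ℕ} {f : ℕ → Set ℕ → ℕ}
    (hQ : ∀ c N, IsNeighborColors k P c N → f c N ∈ Q)
    (hf : ∀ c c' N N', IsNeighborColors k P c N → IsNeighborColors k P c' N' →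
      c ∈ N' → c' ∈ N → f c N ≠ f c' N')
    (hG : DegreeBound G W k) (hφ : IsProperOn G W P φ) :
    IsProperOn G W Q (recolor G f φ) where
  mem _ hv := hQ _ _ (hφ.isNeighborColors hG hv)
  ne u v huv := hf _ _ _ _ (hφ.isNeighborColors hG (hG.left_mem u v huv))
    (hφ.isNeighborColors hG (hG.left_mem v u huv.symm)) ⟨u, huv.symm, rfl⟩ ⟨v, huv, rfl⟩

theorem Reduces.of_step {k : ℕ} {P Q : Set ℕ} (f : ℕ → Set ℕ → ℕ)
    (hQ : ∀ c N, IsNeighborColors k P c N → f c N ∈ Q)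
    (hf : ∀ c c' N N', IsNeighborColors k P c N → IsNeighborColors k P c' N' →
      c ∈ N' → c' ∈ N → f c N ≠ f c' N') : Reduces.{u} k 1 P Q :=
  ⟨[f], rfl, fun _ _ _ hG _ hφ => hφ.recolor hQ hf hG⟩

/-! ### Linial's colour reduction -/

theorem exists_polynomial_family (q d m : ℕ) [Fact q.Prime] (hm : m ≤ q ^ (d + 1)) :
    ∃ p : ℕ → Polynomial (ZMod q), (∀ c, (p c).natDegree ≤ d) ∧ Set.InjOn p (Set.Iio m) := by
  have hcard : Fintype.card (Fin m) ≤ Fintype.card (Fin (d + 1) → ZMod q) := by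
    simpa [ZMod.card] using hm
  obtain ⟨g⟩ := Function.Embedding.nonempty_of_card_le hcard
  let E := Polynomial.degreeLTEquiv (ZMod q) (d + 1)
  refine ⟨fun c => if h : c < m then (E.symm (g ⟨c, h⟩) : Polynomial (ZMod q)) else 0,
    fun c => ?_, fun c hc c' hc' h => ?_⟩
  · dsimp only
    split_ifs with h
    · have := (E.symm (g ⟨c, h⟩)).2
      rw [Polynomial.mem_degreeLT] at this
      by_cases h0 : (E.symm (g ⟨c, h⟩) : Polynomial (ZMod q)) = 0
      · simp [h0]
      · exact Nat.lt_succ_iff.1 ((Polynomial.natDegree_lt_iff_degree_lt h0).2 this)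
    · simp
  · simp only [Set.mem_Iio] at hc hc'
    simp only [hc, hc', dif_pos] at h
    have := g.injective (E.symm.injective (Subtype.ext h))
    simpa using this

/-- Each of the at most `k` differences `p c - p c'` is nonzero and has at most `d` roots, so fewer
than `q` points are bad. -/
theorem exists_eval_ne {q d k : ℕ} [Fact q.Prime] {p : ℕ → Polynomial (ZMod q)} {P N : Set ℕ}
    {c : ℕ} (hp : ∀ c, (p c).natDegree ≤ d) (hinj : Set.InjOn p P) (hq : d * k < q)
    (hN : IsNeighborColors k P c N) :
    ∃ x : ZMod q, ∀ c' ∈ N, (p c).eval x ≠ (p c').eval x := by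
  classical
  let B : Finset (ZMod q) := hN.finite.toFinset.biUnion fun c' => (p c - p c').roots.toFinset
  have hB : B.card < Fintype.card (ZMod q) := by
    rw [ZMod.card]
    refine lt_of_le_of_lt ?_ hq
    calc B.card ≤ hN.finite.toFinset.card * d := by
          refine Finset.card_biUnion_le_card_mul _ _ _ fun c' _ => ?_
          refine (Multiset.toFinset_card_le _).trans ((Polynomial.card_roots' _).trans ?_)
          exact (Polynomial.natDegree_sub_le _ _).trans (max_le (hp c) (hp c'))
      _ ≤ d * k := by
          rw [mul_comm, ← Set.ncard_eq_toFinset_card _ hN.finite]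
          exact Nat.mul_le_mul_left d hN.ncard_le
  obtain ⟨x, hx⟩ : ∃ x, x ∉ B := by
    by_contra! h
    exact hB.ne (by rw [Finset.eq_univ_iff_forall.2 h, Finset.card_univ])
  refine ⟨x, fun c' hc' h => hx ?_⟩
  refine Finset.mem_biUnion.2 ⟨c', hN.finite.mem_toFinset.2 hc', ?_⟩
  rw [Multiset.mem_toFinset, Polynomial.mem_roots']
  refine ⟨fun h0 => hN.notMem ?_, by simp [Polynomial.IsRoot, h]⟩
  rwa [hinj hN.mem (hN.subset hc') (sub_eq_zero.1 h0)]

theorem add_mul_lt_sq {q a b : ℕ} (ha : a < q) (hb : b < q) : a * q + b < q ^ 2 := by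
  nlinarith

/-- The new colour encodes the pair `(x, p_c(x))` in base `q`, with `x` a point where `p_c` differs
from all neighbouring polynomials. Neighbours with equal pairs would agree at such an `x`. -/
theorem Reduces.linial {k q d m : ℕ} (hprime : q.Prime) (hq : d * k < q)
    (hm : m ≤ q ^ (d + 1)) : Reduces.{u} k 1 (Set.Iio m) (Set.Iio (q ^ 2)) := by
  classical
  have : Fact q.Prime := ⟨hprime⟩
  obtain ⟨p, hp, hinj⟩ := exists_polynomial_family q d m hm
  let pt : ℕ → Set ℕ → ZMod q := fun c N =>
    if h : ∃ x : ZMod q, ∀ c' ∈ N, (p c).eval x ≠ (p c').eval x then h.choose else 0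
  refine Reduces.of_step (fun c N => (pt c N).val * q + ((p c).eval (pt c N)).val)
    (fun c N _ => add_mul_lt_sq (ZMod.val_lt _) (ZMod.val_lt _)) ?_
  intro c c' N N' hN _ _ hc' h
  have hdiv : (pt c N).val = (pt c' N').val := by
    have := congrArg (· / q) h
    simpa [Nat.add_div_of_dvd_right, Nat.div_eq_of_lt (ZMod.val_lt _), hprime.pos] using this
  have hpt := ZMod.val_injective q hdiv
  have heval : (p c).eval (pt c N) = (p c').eval (pt c N) := by
    rw [← hpt] at h
    exact ZMod.val_injective q (Nat.add_left_cancel h)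
  have hex := exists_eval_ne hp hinj hq hN
  have : pt c N = hex.choose := dif_pos hex
  exact hex.choose_spec c' hc' (this ▸ heval)

/-! ### Removing colours one by one -/

theorem IsNeighborColors.exists_free {k : ℕ} {P : Set ℕ} {c : ℕ} {N : Set ℕ}
    (hN : IsNeighborColors k P c N) : ∃ x ≤ k, x ∉ N := by
  by_contra! h
  have : (Set.Iic k).ncard ≤ N.ncard := Set.ncard_le_ncard h hN.finite
  have h2 := hN.ncard_le
  rw [← Finset.coe_Iic, Set.ncard_coe_finset, Nat.card_Iic] at this
  omega

/-- Only colour `j` is replaced, by the least free colour. Its class is independent, so no two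
neighbours change simultaneously. -/
theorem Reduces.remove_color {k j : ℕ} (hj : k < j) :
    Reduces.{u} k 1 (Set.Iio (j + 1)) (Set.Iio j) := by
  classical
  have hfree : ∀ c N, IsNeighborColors k (Set.Iio (j + 1)) c N →
      sInf {x | x ∉ N} ≤ k ∧ sInf {x | x ∉ N} ∉ N := fun c N hN => by
    obtain ⟨x, hx, hxN⟩ := hN.exists_free
    exact ⟨(Nat.sInf_le hxN).trans hx, Nat.sInf_mem (s := {x | x ∉ N}) ⟨x, hxN⟩⟩
  refine Reduces.of_step (fun c N => if c = j then sInf {x | x ∉ N} else c) ?_ ?_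
  · intro c N hN
    have h1 := hN.mem
    have h2 := (hfree c N hN).1
    simp only [Set.mem_Iio] at h1 ⊢
    split_ifs <;> omega
  · intro c c' N N' hN hN' hc hc'
    have h1 := (hfree c N hN).2
    have h2 := (hfree c' N' hN').2
    have h3 := hN.notMem
    split_ifs with h h' h'
    · subst h h'; exact absurd hc' h3
    · exact fun e => h1 (e ▸ hc')
    · exact fun e => h2 (e ▸ hc)
    · exact fun e => h3 (e ▸ hc')

theorem Reduces.remove_colors (k j : ℕ) :
    Reduces.{u} k j (Set.Iio (k + 1 + j)) (Set.Iio (k + 1)) := by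
  induction j with
  | zero => exact .refl
  | succ j ih =>
    rw [Nat.add_comm j 1]
    exact (Reduces.remove_color (by omega)).trans ih |>.mono (by intro x; simp; omega) subset_rfl

theorem Reduces.shift (k m : ℕ) : Reduces.{u} k 1 (Set.Iio m) (Set.Icc 1 m) := by
  refine Reduces.of_step (fun c _ => c + 1) (fun c N hN => ?_) fun c c' N N' hN _ _ hc' h => ?_
  · have := hN.mem
    simp only [Set.mem_Iio, Set.mem_Icc] at *
    omega
  · exact hN.notMem (Nat.succ_injective h ▸ hc')

/-! ### The additive group colouring -/

open Classical in
/-- The recolouring step of the additive group algorithm: the colour `a * q + b` becomes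
`a * q + (b + a)` if a neighbour has the same last digit `b`, and `b` otherwise. -/
def additiveStep (q c : ℕ) (N : Set ℕ) : ℕ :=
  if ∃ c' ∈ N, c' % q = c % q then c / q * q + (c % q + c / q) % q else c % q

section AdditiveGroup

variable {V : Type*} {G : SimpleGraph V} {W : Set V} {k q : ℕ} {P : Set ℕ} {φ : V → ℕ}

theorem eq_of_div_eq_of_mod_eq {q c c' : ℕ} (h₁ : c / q = c' / q) (h₂ : c % q = c' % q) :
    c = c' := by
  rw [← Nat.div_add_mod c q, ← Nat.div_add_mod c' q, h₁, h₂]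

theorem mul_add_mod_div {q : ℕ} (hq : 0 < q) (a x : ℕ) : (a * q + x % q) / q = a := by
  rw [Nat.mul_comm, Nat.mul_add_div hq, Nat.div_eq_of_lt (Nat.mod_lt x hq), Nat.add_zero]

theorem additiveStep_of_exists (hq : 0 < q) {c : ℕ} {N : Set ℕ} (h : ∃ c' ∈ N, c' % q = c % q) :
    additiveStep q c N / q = c / q ∧ additiveStep q c N % q = (c % q + c / q) % q := by
  rw [additiveStep, if_pos h]
  exact ⟨mul_add_mod_div hq _ _, by rw [Nat.mul_add_mod_self_right, Nat.mod_mod]⟩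

theorem additiveStep_of_not_exists (hq : 0 < q) {c : ℕ} {N : Set ℕ}
    (h : ¬ ∃ c' ∈ N, c' % q = c % q) :
    additiveStep q c N / q = 0 ∧ additiveStep q c N % q = c % q := by
  rw [additiveStep, if_neg h]
  exact ⟨Nat.div_eq_of_lt (Nat.mod_lt _ hq), Nat.mod_mod _ _⟩

theorem additiveStep_div (hq : 0 < q) (c : ℕ) (N : Set ℕ) :
    additiveStep q c N / q = c / q ∨ additiveStep q c N / q = 0 := by
  by_cases h : ∃ c' ∈ N, c' % q = c % q
  · exact .inl (additiveStep_of_exists hq h).1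
  · exact .inr (additiveStep_of_not_exists hq h).1

/-- One formula for both branches: the last digit grows by the new leading digit, which is zero once
the vertex is final. -/
theorem additiveStep_mod (hq : 0 < q) (c : ℕ) (N : Set ℕ) :
    additiveStep q c N % q = (c % q + additiveStep q c N / q) % q := by
  by_cases h : ∃ c' ∈ N, c' % q = c % q
  · rw [(additiveStep_of_exists hq h).1, (additiveStep_of_exists hq h).2]
  · rw [(additiveStep_of_not_exists hq h).1, (additiveStep_of_not_exists hq h).2, Nat.add_zero,
      Nat.mod_mod]

theorem additiveStep_lt (hq : 0 < q) {c : ℕ} (hc : c < q ^ 2) (N : Set ℕ) :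
    additiveStep q c N < q ^ 2 := by
  rw [sq] at *
  rw [← Nat.div_lt_iff_lt_mul hq] at *
  rcases additiveStep_div hq c N with h | h <;> omega

/-- Equal results have equal leading digits, so by `additiveStep_mod` the old last digits agree too.
Then both vertices were in conflict and kept their leading digits, which forces `c = c'`. -/
theorem additiveStep_ne (hq : 0 < q) {c c' : ℕ} {N N' : Set ℕ} (hne : c ≠ c') (hc : c ∈ N')
    (hc' : c' ∈ N) : additiveStep q c N ≠ additiveStep q c' N' := by
  intro h
  have hd : additiveStep q c N / q = additiveStep q c' N' / q := by rw [h]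
  have hm : additiveStep q c N % q = additiveStep q c' N' % q := by rw [h]
  have hmod : c % q = c' % q := by
    rw [additiveStep_mod hq c, additiveStep_mod hq c', hd] at hm
    have : c % q ≡ c' % q [MOD q] := Nat.ModEq.add_right_cancel' _ hm
    simpa [Nat.ModEq] using this
  rw [(additiveStep_of_exists hq ⟨c', hc', hmod.symm⟩).1,
    (additiveStep_of_exists hq ⟨c, hc, hmod⟩).1] at hd
  exact hne (eq_of_div_eq_of_mod_eq hd hmod)

/-- The colouring after `t` steps of the additive group algorithm. -/
def additiveRun (G : SimpleGraph V) (q : ℕ) (φ : V → ℕ) (t : ℕ) : V → ℕ :=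
  recolorList G (List.replicate t (additiveStep q)) φ

theorem additiveRun_succ (t : ℕ) (v : V) : additiveRun G q φ (t + 1) v =
    additiveStep q (additiveRun G q φ t v) (additiveRun G q φ t '' G.neighborSet v) := by
  rw [additiveRun, recolorList, List.replicate_succ', List.foldl_append]
  rfl

theorem IsProperOn.additiveRun (hG : DegreeBound G W k) (hq : 0 < q)
    (hφ : IsProperOn G W (Set.Iio (q ^ 2)) φ) (t : ℕ) :
    IsProperOn G W (Set.Iio (q ^ 2)) (additiveRun G q φ t) := by
  induction t with
  | zero => exact hφ
  | succ t ih =>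
    have := ih.recolor (f := additiveStep q) (Q := Set.Iio (q ^ 2)) (fun c N hN => additiveStep_lt hq hN.mem N)
      (fun c c' N N' hN _ hc hc' => additiveStep_ne hq (fun e => hN.notMem (e ▸ hc')) hc hc') hG
    exact ⟨fun v hv => by rw [additiveRun_succ]; exact this.mem v hv,
      fun u v h => by rw [additiveRun_succ, additiveRun_succ]; exact this.ne u v h⟩

theorem additiveRun_div_eq_zero (hq : 0 < q) {v : V} {s t : ℕ} (hst : s ≤ t)
    (h : additiveRun G q φ s v / q = 0) : additiveRun G q φ t v / q = 0 := by
  induction t, hst using Nat.le_induction with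
  | base => exact h
  | succ t _ ih =>
    rw [additiveRun_succ]
    rcases additiveStep_div hq (additiveRun G q φ t v) (additiveRun G q φ t '' G.neighborSet v)
      with h | h <;> omega

theorem additiveRun_mod_of_zero (hq : 0 < q) {v : V} {s t : ℕ} (hst : s ≤ t)
    (h : additiveRun G q φ s v / q = 0) :
    additiveRun G q φ t v % q = additiveRun G q φ s v % q := by
  induction t, hst using Nat.le_induction with
  | base => rfl
  | succ t hst ih =>
    have h0 := additiveRun_div_eq_zero hq (hst.trans t.le_succ) h
    rw [additiveRun_succ] at h0 ⊢
    rw [additiveStep_mod hq, h0, ← ih, Nat.add_zero, Nat.mod_mod]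

/-- Modulo `q` a colour is its last digit. Until a vertex is final, this digit moves along a line
whose slope is the initial leading digit. -/
theorem additiveRun_of_ne_zero (hq : 0 < q) {v : V} {t : ℕ}
    (h : additiveRun G q φ t v / q ≠ 0) :
    additiveRun G q φ t v / q = φ v / q ∧
      ((additiveRun G q φ t v : ℕ) : ZMod q) = (φ v : ZMod q) + t * ((φ v / q : ℕ) : ZMod q) := by
  induction t with
  | zero => exact ⟨rfl, by simp [additiveRun, recolorList]⟩
  | succ t ih =>
    obtain ⟨h1, h2⟩ := ih fun h0 => h (additiveRun_div_eq_zero hq t.le_succ h0)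
    rw [additiveRun_succ] at h ⊢
    have h3 := (additiveStep_div hq (additiveRun G q φ t v)
      (additiveRun G q φ t '' G.neighborSet v)).resolve_right h
    have h4 := additiveStep_mod hq (additiveRun G q φ t v)
      (additiveRun G q φ t '' G.neighborSet v)
    refine ⟨h3.trans h1, ?_⟩
    rw [h3, h1] at h4
    have h5 := congrArg (Nat.cast : ℕ → ZMod q) h4
    simp only [ZMod.natCast_mod, Nat.cast_add] at h5
    rw [h5, h2]
    push_cast
    ring

/-- Two lines of different slopes over the field `ZMod q` meet at most once in `q` rounds; a final
neighbour is a line of slope zero. Equal slopes together with a conflict would give neighbours the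
same colour. -/
theorem additiveRun_conflict_unique (hprime : q.Prime) (hG : DegreeBound G W k)
    (hφ : IsProperOn G W (Set.Iio (q ^ 2)) φ) {u v : V} (huv : G.Adj u v) {s t : ℕ}
    (hst : s < t) (ht : t < q) (hv : additiveRun G q φ t v / q ≠ 0)
    (hs₀ : additiveRun G q φ s u % q = additiveRun G q φ s v % q)
    (ht₀ : additiveRun G q φ t u % q = additiveRun G q φ t v % q)
    (hiff : additiveRun G q φ s u / q = 0 ↔ additiveRun G q φ t u / q = 0) : False := by
  have : Fact q.Prime := ⟨hprime⟩
  have hq := hprime.pos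
  have hcast : ∀ {c c' : ℕ}, c % q = c' % q → (c : ZMod q) = c' := fun h =>
    (ZMod.natCast_eq_natCast_iff' _ _ _).2 h
  have hdivlt : ∀ w ∈ W, φ w / q < q := fun w hw => by
    rw [Nat.div_lt_iff_lt_mul hq, ← sq]; exact hφ.mem w hw
  have hcast' : ∀ {c c' : ℕ}, c < q → c' < q → (c : ZMod q) = c' → c = c' := fun h h' e => by
    rw [ZMod.natCast_eq_natCast_iff'] at e
    rwa [Nat.mod_eq_of_lt h, Nat.mod_eq_of_lt h'] at e
  have htime : ((t : ZMod q) - s) ≠ 0 := fun h =>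
    hst.ne' (hcast' ht (hst.trans ht) (sub_eq_zero.1 h))
  have hvs : additiveRun G q φ s v / q ≠ 0 := fun h => hv (additiveRun_div_eq_zero hq hst.le h)
  obtain ⟨hv1, hv2⟩ := additiveRun_of_ne_zero hq hv
  obtain ⟨-, hv4⟩ := additiveRun_of_ne_zero hq hvs
  have hvW := hG.left_mem v u huv.symm
  have huW := hG.left_mem u v huv
  by_cases hu : additiveRun G q φ t u / q = 0
  · have hu' := hiff.2 hu
    have h1 := hcast ((additiveRun_mod_of_zero hq hst.le hu').symm.trans ht₀)
    have h2 := (hcast hs₀).symm.trans h1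
    rw [hv2, hv4] at h2
    have h3 : ((t : ZMod q) - s) * ((φ v / q : ℕ) : ZMod q) = 0 := by linear_combination -h2
    have h4 := (mul_eq_zero.1 h3).resolve_left htime
    refine hv (hv1.trans (hcast' (hdivlt v hvW) hq ?_))
    simpa using h4
  · obtain ⟨hu1, hu2⟩ := additiveRun_of_ne_zero hq hu
    obtain ⟨-, hu4⟩ := additiveRun_of_ne_zero hq (mt hiff.1 hu)
    have h1 := hcast hs₀
    have h2 := hcast ht₀
    rw [hv2, hu2] at h2
    rw [hv4, hu4] at h1
    have h3 : ((t : ZMod q) - s) * (((φ u / q : ℕ) : ZMod q) - ((φ v / q : ℕ) : ZMod q)) = 0 := by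
      linear_combination h2 - h1
    have h4 := hcast' (hdivlt u huW) (hdivlt v hvW)
      (sub_eq_zero.1 ((mul_eq_zero.1 h3).resolve_left htime))
    exact (hφ.additiveRun hG hq t).ne u v huv
      (eq_of_div_eq_of_mod_eq (by rw [hu1, hv1, h4]) ht₀)

/-- A vertex that is not final after `q` rounds had a conflict in each of them. Each neighbour
accounts for at most two: one while it moves and one after it is final. This contradicts `2 * k <
q`. -/
theorem additiveRun_div_eq_zero_of_two_mul_lt (hprime : q.Prime) (hkq : 2 * k < q)
    (hG : DegreeBound G W k) (hφ : IsProperOn G W (Set.Iio (q ^ 2)) φ) (v : V) :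
    additiveRun G q φ q v / q = 0 := by
  classical
  by_contra hv
  have hq := hprime.pos
  have hvt : ∀ t ≤ q, additiveRun G q φ t v / q ≠ 0 := fun t ht h =>
    hv (additiveRun_div_eq_zero hq ht h)
  have hconf : ∀ t, ∃ u, t < q → u ∈ G.neighborSet v ∧
      additiveRun G q φ t u % q = additiveRun G q φ t v % q := by
    intro t
    by_cases ht : t < q
    · by_contra! h
      have h' : ¬ ∃ c' ∈ additiveRun G q φ t '' G.neighborSet v,
          c' % q = additiveRun G q φ t v % q := by
        rintro ⟨_, ⟨u, hu, rfl⟩, he⟩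
        exact (h u).2 hu he
      apply hvt (t + 1) ht
      rw [additiveRun_succ]
      exact (additiveStep_of_not_exists hq h').1
    · exact ⟨v, fun h => absurd h ht⟩
  choose u hu using hconf
  have hcard := Finset.card_le_card_of_injOn (s := Finset.range q)
    (t := (hG.finite v).toFinset ×ˢ (Finset.univ : Finset Bool))
    (fun t => (u t, decide (additiveRun G q φ t (u t) / q = 0)))
    (fun t ht => by
      simp only [Finset.coe_range, Set.mem_Iio] at ht
      exact Finset.mem_product.2 ⟨(hG.finite v).mem_toFinset.2 (hu t ht).1, Finset.mem_univ _⟩)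
    (by
      have key : ∀ s t, s < t → t < q → u s = u t →
          (additiveRun G q φ s (u s) / q = 0 ↔ additiveRun G q φ t (u t) / q = 0) → False := by
        intro s t hst ht he hiff
        have h1 := (hu s (hst.trans ht)).2
        obtain ⟨h3, h2⟩ := hu t ht
        rw [he] at h1 hiff
        exact additiveRun_conflict_unique hprime hG hφ (G.adj_symm h3) hst ht
          (hvt t ht.le) h1 h2 hiff
      intro s hs t ht he
      simp only [Finset.coe_range, Set.mem_Iio, Prod.mk.injEq, decide_eq_decide] at hs ht he
      rcases lt_trichotomy s t with h | h | h
      · exact (key s t h ht he.1 he.2).elim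
      · exact h
      · exact (key t s h hs he.1.symm he.2.symm).elim)
  rw [Finset.card_range, Finset.card_product, ← Set.ncard_eq_toFinset_card _ (hG.finite v)] at hcard
  have := hG.ncard_le v
  simp only [Finset.card_univ, Fintype.card_bool] at hcard
  omega

end AdditiveGroup

theorem Reduces.additive {k q : ℕ} (hprime : q.Prime) (hkq : 2 * k < q) :
    Reduces.{u} k q (Set.Iio (q ^ 2)) (Set.Iio q) := by
  refine ⟨List.replicate q (additiveStep q), by simp, fun V G W hG φ hφ =>
    ⟨fun v _ => ?_, (hφ.additiveRun hG hprime.pos q).ne⟩⟩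
  have := additiveRun_div_eq_zero_of_two_mul_lt hprime hkq hG hφ v
  exact (Nat.div_eq_zero_iff_lt hprime.pos).1 this

/-! ### The iterated logarithm and the schedule of the colour reductions -/

/-- The tower of `j` twos. -/
def tower : ℕ → ℕ
  | 0 => 1
  | j + 1 => 2 ^ tower j

theorem tower_pos (j : ℕ) : 0 < tower j := by
  cases j <;> simp [tower]

theorem lt_tower (j : ℕ) : j < tower j := by
  induction j with
  | zero => simp [tower]
  | succ j ih => exact (Nat.succ_le_of_lt ih).trans_lt Nat.lt_two_pow_self

theorem exists_iterate_logb_le_one (j : ℕ) (x : ℝ) (hx : x ≤ tower j) :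
    ∃ i, (Real.logb 2)^[i] x ≤ 1 := by
  induction j generalizing x with
  | zero => exact ⟨0, by simpa [tower] using hx⟩
  | succ j ih =>
    by_cases h1 : x ≤ 1
    · exact ⟨0, h1⟩
    · obtain ⟨i, hi⟩ := ih (Real.logb 2 x) (by
        rw [Real.logb_le_iff_le_rpow one_lt_two (by linarith), Real.rpow_natCast]
        simpa [tower] using hx)
      exact ⟨i + 1, hi⟩

theorem le_tower_of_iterate_logb_le_one (i : ℕ) (x : ℝ) (hx : (Real.logb 2)^[i] x ≤ 1) :
    x ≤ tower i := by
  induction i generalizing x with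
  | zero => simpa [tower] using hx
  | succ i ih =>
    by_cases h0 : x ≤ 0
    · exact h0.trans (Nat.cast_nonneg _)
    · have := ih _ hx
      rw [Real.logb_le_iff_le_rpow one_lt_two (by linarith), Real.rpow_natCast] at this
      simpa [tower] using this

/-- The set defining `logStar n` must be shown nonempty, since otherwise `sInf` would return the
junk value 0. -/
theorem le_tower_logStar (n : ℕ) : n ≤ tower (logStar n) := by
  have hne : {k : ℕ | (Real.logb 2)^[k] n ≤ 1}.Nonempty :=
    exists_iterate_logb_le_one n n (by exact_mod_cast (lt_tower n).le)
  exact_mod_cast le_tower_of_iterate_logb_le_one _ _ (Nat.sInf_mem hne)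

theorem four_mul_add_six_le_two_pow {a : ℕ} (ha : 5 ≤ a) : 4 * a + 6 ≤ 2 ^ a := by
  induction a, ha using Nat.le_induction with
  | base => norm_num
  | succ a _ ih => rw [pow_succ]; omega

/-- This lets one Linial round remove one level of the tower; the factor `2 ^ a` absorbs the
constant and the fourth power. -/
theorem four_mul_pow_four_le {a k t : ℕ} (ha : 5 ≤ a) (hk : 1 ≤ k) (ht : 1 ≤ t) :
    4 * (2 ^ a * k * 2 ^ t) ^ 4 ≤ 2 ^ (2 ^ a * k * t) := by
  obtain ⟨k, rfl⟩ := Nat.exists_eq_add_of_le' hk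
  have hexp : 2 + 4 * (a + k + t) ≤ 2 ^ a * (k + 1) * t := by
    have h1 := four_mul_add_six_le_two_pow ha
    have h2 : k + t ≤ (k + 1) * t := by nlinarith
    calc 2 + 4 * (a + k + t) ≤ (4 * a + 6) * (k + t) := by nlinarith
      _ ≤ 2 ^ a * ((k + 1) * t) := Nat.mul_le_mul h1 h2
      _ = _ := by ring
  have hk2 : k + 1 ≤ 2 ^ k := Nat.lt_two_pow_self
  calc 4 * (2 ^ a * (k + 1) * 2 ^ t) ^ 4 ≤ 4 * (2 ^ a * 2 ^ k * 2 ^ t) ^ 4 := by gcongr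
    _ = 2 ^ (2 + 4 * (a + k + t)) := by
      rw [← pow_add, ← pow_add, ← pow_mul, pow_add 2 2]
      congr 2
      ring
    _ ≤ _ := Nat.pow_le_pow_right two_pos hexp

theorem Reduces.two_pow {k L : ℕ} (hk : 1 ≤ k) (hL : k ≤ L) :
    Reduces.{u} k 1 (Set.Iio (2 ^ L)) (Set.Iio (4 * L ^ 4)) := by
  have hpos : L ^ 2 ≠ 0 := pow_ne_zero 2 (by omega)
  obtain ⟨q, hq, h1, h2⟩ := Nat.exists_prime_lt_and_le_two_mul (L ^ 2) hpos
  have hlin : Reduces.{u} k 1 (Set.Iio (2 ^ L)) (Set.Iio (q ^ 2)) := by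
    -- Degree `L` suffices for `2 ^ L` colours because `q ≥ 2`, and `L * k ≤ L ^ 2 < q`.
    refine Reduces.linial (d := L) hq ?_ ?_
    · nlinarith
    · exact (Nat.pow_le_pow_left hq.two_le L).trans (Nat.pow_le_pow_right hq.pos L.le_succ)
  refine hlin.mono subset_rfl (Set.Iio_subset_Iio ?_)
  calc q ^ 2 ≤ (2 * L ^ 2) ^ 2 := by gcongr
    _ = 4 * L ^ 4 := by ring

theorem Reduces.two_pow_tower {a k : ℕ} (ha : 5 ≤ a) (hk : 1 ≤ k) (j : ℕ) :
    Reduces.{u} k j (Set.Iio (2 ^ (2 ^ a * k * tower j))) (Set.Iio (2 ^ (2 ^ a * k))) := by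
  induction j with
  | zero => simpa [tower] using Reduces.refl
  | succ j ih =>
    rw [Nat.add_comm j 1]
    refine Reduces.trans ((Reduces.two_pow hk ?_).mono ?_
      (Set.Iio_subset_Iio (four_mul_pow_four_le ha hk (tower_pos j)))) ih
    · rw [mul_right_comm]
      exact Nat.le_mul_of_pos_left k (by positivity)
    · rw [Nat.add_comm 1 j]
      rfl

theorem Reduces.exists_two_pow_mul {a k : ℕ} (hk : 1 ≤ k) :
    ∃ T ≤ 15 * 2 ^ a * k,
      Reduces.{u} k T (Set.Iio (2 ^ (2 ^ a * k))) (Set.Icc 1 (k + 1)) := by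
  set K := 2 ^ a * k with hK
  have hkK : k ≤ K := Nat.le_mul_of_pos_left k (by positivity)
  obtain ⟨q, hq, h1, h2⟩ := Nat.exists_prime_lt_and_le_two_mul (3 * K) (by omega)
  have hlin : Reduces.{u} k 1 (Set.Iio (4 * K ^ 4)) (Set.Iio (q ^ 2)) := by
    refine Reduces.linial (d := 3) hq (by omega) ?_
    calc 4 * K ^ 4 ≤ (3 * K) ^ 4 := by rw [mul_pow 3 K 4]; exact Nat.mul_le_mul_right _ (by norm_num : 4 ≤ 3 ^ 4)
      _ ≤ q ^ 4 := by gcongr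
  -- Two Linial rounds, `q` additive rounds, `q` removals and the shift: `2 * q + 3 ≤ 15 * K`, as `q
  -- ≤ 6 * K` and `K ≥ 1`.
  refine ⟨1 + 1 + q + q + 1, by rw [mul_assoc, ← hK]; omega, ?_⟩
  refine ((((Reduces.two_pow hk hkK).trans hlin).trans
    (Reduces.additive hq (by omega))).trans ?_).trans (Reduces.shift k (k + 1))
  exact (Reduces.remove_colors k q).mono (Set.Iio_subset_Iio (by omega)) subset_rfl

theorem exists_reduces (c : ℕ) : ∃ A : ℕ, ∀ n k : ℕ, 1 ≤ k →
    ∃ T ≤ A * (k + logStar n), Reduces.{u} k T (Set.Iic (n ^ c)) (Set.Icc 1 (k + 1)) := by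
  -- The bound `c + 1 ≤ 2 ^ a` makes room for identifiers up to `n ^ c`; `a` depends on `c` alone.
  obtain ⟨a, ha, hca⟩ : ∃ a, 5 ≤ a ∧ c + 1 ≤ 2 ^ a :=
    ⟨c + 5, by omega, by have := Nat.lt_two_pow_self (n := c + 5); omega⟩
  refine ⟨15 * 2 ^ a, fun n k hk => ?_⟩
  obtain ⟨T, hT, hred⟩ := Reduces.exists_two_pow_mul.{u} (a := a) hk
  refine ⟨logStar n + T, ?_, ((Reduces.two_pow_tower ha hk (logStar n)).trans hred).mono ?_
    subset_rfl⟩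
  · have : 1 ≤ 15 * 2 ^ a := Nat.succ_le_of_lt (by positivity)
    nlinarith
  · intro x hx
    have hn := le_tower_logStar n
    have hpos := tower_pos (logStar n)
    rw [Set.mem_Iic] at hx
    rw [Set.mem_Iio]
    calc x ≤ n ^ c := hx
      _ ≤ (2 ^ n) ^ c := Nat.pow_le_pow_left Nat.lt_two_pow_self.le c
      _ = 2 ^ (n * c) := (pow_mul _ _ _).symm
      _ < 2 ^ (n * c + 1) := Nat.pow_lt_pow_right one_lt_two (Nat.lt_succ_self _)
      _ ≤ 2 ^ (2 ^ a * k * tower (logStar n)) := by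
        refine Nat.pow_le_pow_right two_pos ?_
        calc n * c + 1 ≤ (c + 1) * 1 * tower (logStar n) := by nlinarith
          _ ≤ 2 ^ a * k * tower (logStar n) := by gcongr

/-! ### Splitting the edges -/

section EdgePart

variable {X : Type*} {f : X → ℕ} {e : Set X}

theorem ncard_lt_injOn (he : e.Finite) (hf : Set.InjOn f e) :
    Set.InjOn (fun x => {y ∈ e | f y < f x}.ncard) e := by
  have key : ∀ x ∈ e, ∀ x', f x < f x' →
      {y ∈ e | f y < f x}.ncard < {y ∈ e | f y < f x'}.ncard := by
    intro x hx x' h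
    refine Set.ncard_lt_ncard ⟨fun y hy => ⟨hy.1, hy.2.trans h⟩, fun hs => ?_⟩
      (he.subset fun y hy => hy.1)
    exact lt_irrefl _ (hs (⟨hx, h⟩ : x ∈ {y ∈ e | f y < f x'})).2
  intro x hx x' hx' h
  dsimp only at h
  rcases lt_trichotomy (f x) (f x') with h' | h' | h'
  · exact absurd h (key x hx x' h').ne
  · exact hf hx hx' h'
  · exact absurd h (key x' hx' x h').ne'

theorem ncard_edgePart_le (he : e.Finite) (hf : Set.InjOn f e) {b : ℕ} (hb : 0 < b) (i : ℕ) :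
    (edgePart f b e i).ncard ≤ b := by
  have hsub : edgePart f b e i ⊆ e := fun x hx => hx.1
  calc (edgePart f b e i).ncard
      ≤ (Set.Ico (b * i) (b * i + b)).ncard := by
        refine Set.ncard_le_ncard_of_injOn (fun x => {y ∈ e | f y < f x}.ncard) ?_
          ((ncard_lt_injOn he hf).mono hsub) (Set.finite_Ico _ _)
        intro x hx
        have := hx.2
        rw [Set.mem_Ico, ← this]
        exact ⟨Nat.mul_div_le _ _, Nat.lt_mul_div_succ _ hb⟩
    _ = b := by rw [← Finset.coe_Ico, Set.ncard_coe_finset, Nat.card_Ico]; omega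

/-- Vertices see edges only as sets of identifiers; the cut they compute there is the true one. -/
theorem image_edgePart (hf : Set.InjOn f e) (b i : ℕ) :
    f '' edgePart f b e i = edgePart (fun m => m) b (f '' e) i := by
  have hcount : ∀ x, {m ∈ f '' e | m < f x}.ncard = {y ∈ e | f y < f x}.ncard := by
    intro x
    rw [← (hf.mono fun y (hy : y ∈ {y ∈ e | f y < f x}) => hy.1).ncard_image]
    congr 1
    ext m
    constructor
    · rintro ⟨⟨y, hy, rfl⟩, h⟩
      exact ⟨y, ⟨hy, h⟩, rfl⟩
    · rintro ⟨y, ⟨hy, h⟩, rfl⟩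
      exact ⟨⟨y, hy, rfl⟩, h⟩
  ext m
  constructor
  · rintro ⟨x, ⟨hx, hi⟩, rfl⟩
    exact ⟨⟨x, hx, rfl⟩, by rw [hcount, hi]⟩
  · rintro ⟨⟨x, hx, rfl⟩, hi⟩
    exact ⟨x, ⟨hx, by rw [← hcount, hi]⟩, rfl⟩

theorem le_blockLength_mul {r δ : ℕ} (hδ : 0 < δ) : r ≤ δ * blockLength r δ := by
  have := Nat.lt_mul_div_succ (r + δ - 1) hδ
  rw [blockLength]
  rw [mul_add, mul_one] at this
  omega

theorem blockLength_sub_one_mul_le (r δ : ℕ) : (blockLength r δ - 1) * δ ≤ r := by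
  have := Nat.div_mul_le_self (r + δ - 1) δ
  rw [blockLength, Nat.sub_mul, one_mul]
  omega

end EdgePart

/-! ### Degrees, colour classes and local views of the split hypergraph -/

namespace Hypergraph

variable {V : Type*} {H : Hypergraph V} {ident : V → ℕ} {δ : ℕ}

theorem finite_of_mem_edgeSet (hV : V(H).Finite) {e : Set V} (he : e ∈ E(H)) : e.Finite :=
  hV.subset he.subset_vertexSet

theorem finite_edgeSet (hV : V(H).Finite) : E(H).Finite :=
  hV.finite_subsets.subset edgeSet_subset_powerset_vertexSet

theorem ncard_le_rank (hV : V(H).Finite) {e : Set V} (he : e ∈ E(H)) : e.ncard ≤ H.rank :=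
  le_csSup ((finite_edgeSet hV).image _).bddAbove ⟨e, he, rfl⟩

theorem degree_le_maxDegree (hV : V(H).Finite) {v : V} (hv : v ∈ V(H)) :
    H.degree v ≤ H.maxDegree :=
  le_csSup (hV.image _).bddAbove ⟨v, hv, rfl⟩

theorem one_le_maxDegree (hV : V(H).Finite) (h : 1 ≤ H.rank) : 1 ≤ H.maxDegree := by
  have hne : (Set.ncard '' E(H)).Nonempty := by
    by_contra h0
    rw [Set.not_nonempty_iff_eq_empty] at h0
    rw [rank, h0] at h
    simp at h
  obtain ⟨e, he, hr⟩ := Nat.sSup_mem hne ((finite_edgeSet hV).image _).bddAbove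
  have hr' : e.ncard = H.rank := hr
  obtain ⟨v, hv⟩ := Set.nonempty_of_ncard_ne_zero (s := e) (by omega)
  refine le_trans ?_ (degree_le_maxDegree hV (mem_vertexSet_of_mem_edgeSet he hv))
  exact (Set.ncard_pos ((finite_edgeSet hV).subset fun _ h => h.1)).2 ⟨e, he, hv⟩

theorem underlyingGraph_adj_left_mem {u v : V} (h : H.underlyingGraph.Adj u v) : u ∈ V(H) := by
  obtain ⟨-, e, he, hu, -⟩ := h
  exact mem_vertexSet_of_mem_edgeSet he hu

theorem adj_of_split_adj {u v : V} (h : (H.split ident δ).underlyingGraph.Adj u v) :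
    H.underlyingGraph.Adj u v := by
  obtain ⟨hne, _, ⟨e, he, i, -, rfl⟩, hu, hv⟩ := h
  exact ⟨hne, e, he, hu.1, hv.1⟩

theorem edgePart_index_lt (hV : V(H).Finite) (hδ : 0 < δ) {e : Set V} (he : e ∈ E(H)) {v : V}
    (hv : v ∈ e) : {y ∈ e | ident y < ident v}.ncard / blockLength H.rank δ < δ := by
  have hfin := finite_of_mem_edgeSet hV he
  have h1 : {y ∈ e | ident y < ident v}.ncard < e.ncard :=
    Set.ncard_lt_ncard ⟨fun y hy => hy.1, fun hs => lt_irrefl _ (hs hv).2⟩ hfin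
  refine Nat.div_lt_of_lt_mul ?_
  rw [mul_comm]
  exact (h1.trans_le (ncard_le_rank hV he)).trans_le (le_blockLength_mul hδ)

theorem split_degreeBound (hV : V(H).Finite) (hinj : Set.InjOn ident V(H)) (hδ : 0 < δ)
    (hδr : δ ≤ H.rank) :
    DegreeBound (H.split ident δ).underlyingGraph V(H) (H.maxDegree * H.rank / δ) where
  left_mem u v h := underlyingGraph_adj_left_mem (adj_of_split_adj h)
  finite v := hV.subset fun u hu => underlyingGraph_adj_left_mem (adj_of_split_adj hu).symm
  ncard_le v := by
    classical
    by_cases hv : v ∈ V(H)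
    swap
    · have : (H.split ident δ).underlyingGraph.neighborSet v = ∅ :=
        Set.eq_empty_of_forall_notMem fun u hu => hv (underlyingGraph_adj_left_mem (adj_of_split_adj hu))
      simp [this]
    set b := blockLength H.rank δ with hb
    have hbpos : 0 < b := by
      have := le_blockLength_mul (r := H.rank) hδ
      rw [← hb] at this
      exact Nat.pos_of_ne_zero fun h => by rw [h, mul_zero] at this; omega
    have hEfin : {e ∈ E(H) | v ∈ e}.Finite := (finite_edgeSet hV).subset fun _ h => h.1
    -- An edge at `v` contributes only the other vertices of the part containing `v`, at most `b -
    -- 1`.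
    let part : Set V → Set V := fun e =>
      edgePart ident b e ({y ∈ e | ident y < ident v}.ncard / b) \ {v}
    have hsub : (H.split ident δ).underlyingGraph.neighborSet v ⊆
        ⋃ e ∈ hEfin.toFinset, part e := by
      rintro u ⟨hne, _, ⟨e, he, i, -, rfl⟩, hve, hue⟩
      refine Set.mem_biUnion (x := e) (by simpa using ⟨he, hve.1⟩) ⟨?_, hne.symm⟩
      rwa [hve.2]
    have hpart : ∀ e ∈ hEfin.toFinset, (part e).ncard ≤ b - 1 := by
      intro e he
      obtain ⟨he, hve⟩ := hEfin.mem_toFinset.1 he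
      have hfin := finite_of_mem_edgeSet hV he
      have h1 := ncard_edgePart_le hfin (hinj.mono he.subset_vertexSet) hbpos
        ({y ∈ e | ident y < ident v}.ncard / b)
      have h2 : v ∈ edgePart ident b e ({y ∈ e | ident y < ident v}.ncard / b) := ⟨hve, rfl⟩
      rw [Set.ncard_sdiff_singleton_of_mem h2]
      omega
    have hfinU : (⋃ e ∈ hEfin.toFinset, part e).Finite :=
      hV.subset <| Set.iUnion₂_subset fun e he x hx =>
        mem_vertexSet_of_mem_edgeSet (hEfin.mem_toFinset.1 he).1 hx.1.1
    rw [Nat.le_div_iff_mul_le hδ]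
    calc ((H.split ident δ).underlyingGraph.neighborSet v).ncard * δ
        ≤ (⋃ e ∈ hEfin.toFinset, part e).ncard * δ :=
          Nat.mul_le_mul_right _ (Set.ncard_le_ncard hsub hfinU)
      _ ≤ (∑ e ∈ hEfin.toFinset, (part e).ncard) * δ :=
          Nat.mul_le_mul_right _ (Finset.set_ncard_biUnion_le _ _)
      _ ≤ (H.degree v * (b - 1)) * δ := by
          refine Nat.mul_le_mul_right _ ((Finset.sum_le_card_nsmul _ _ _ hpart).trans_eq ?_)
          rw [smul_eq_mul, degree, ← Set.ncard_eq_toFinset_card _ hEfin]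
      _ ≤ H.maxDegree * H.rank := by
          rw [mul_assoc]
          exact Nat.mul_le_mul (degree_le_maxDegree hV hv) (blockLength_sub_one_mul_le _ _)

/-- In a proper colouring of the split hypergraph, each colour occurs at most `δ` times in an
edge. -/
theorem ncard_color_class_le (hV : V(H).Finite) (hδ : 0 < δ) {Ψ : V → ℕ}
    (hΨ : ∀ u v, (H.split ident δ).underlyingGraph.Adj u v → Ψ u ≠ Ψ v) {e : Set V}
    (he : e ∈ E(H)) (j : ℕ) : {v ∈ e | Ψ v = j}.ncard ≤ δ := by
  calc {v ∈ e | Ψ v = j}.ncard ≤ (Set.Iio δ).ncard := by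
        refine Set.ncard_le_ncard_of_injOn
          (fun v => {y ∈ e | ident y < ident v}.ncard / blockLength H.rank δ)
          (fun v hv => edgePart_index_lt hV hδ he hv.1) ?_ (Set.finite_Iio δ)
        intro u hu v hv h
        by_contra hne
        -- Vertices of the same colour in the same part would be adjacent, so the part index is
        -- injective on the class.
        exact hΨ u v ⟨hne, _, ⟨e, he, _, edgePart_index_lt hV hδ he hv.1, rfl⟩,
          ⟨hu.1, h⟩, ⟨hv.1, rfl⟩⟩ (hu.2.trans hv.2.symm)
    _ = δ := by rw [← Finset.coe_Iio, Set.ncard_coe_finset, Nat.card_Iio]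

/-- Each vertex can start the subroutine on the split hypergraph without communication. -/
theorem localView_split (hinj : Set.InjOn ident V(H)) {v : V} (hv : v ∈ V(H)) :
    (H.localView ident v).split H.rank δ = (H.split ident δ).localView ident v := by
  simp only [LocalView.split, localView, LocalView.mk.injEq, true_and]
  ext q
  constructor
  · rintro ⟨hq, _, ⟨e, ⟨he, hve⟩, rfl⟩, i, hi, rfl⟩
    rw [← image_edgePart (hinj.mono he.subset_vertexSet)] at hq ⊢
    refine ⟨_, ⟨⟨e, he, i, hi, rfl⟩, ?_⟩, rfl⟩
    obtain ⟨x, hx, hxv⟩ := hq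
    rwa [← hinj (he.subset_vertexSet hx.1) hv hxv]
  · rintro ⟨_, ⟨⟨e, he, i, hi, rfl⟩, hvp⟩, rfl⟩
    refine ⟨⟨v, hvp, rfl⟩, _, ⟨e, ⟨he, hvp.1⟩, rfl⟩, i, hi, ?_⟩
    exact image_edgePart (hinj.mono he.subset_vertexSet) _ _

theorem mem_neighbors_localView (hinj : Set.InjOn ident V(H)) {v : V} (hv : v ∈ V(H)) {m : ℕ} :
    m ∈ (H.localView ident v).neighbors ↔ ∃ u, H.underlyingGraph.Adj v u ∧ ident u = m := by
  constructor
  · rintro ⟨hne, _, ⟨e, ⟨he, hve⟩, rfl⟩, u, hu, rfl⟩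
    exact ⟨u, ⟨fun h => hne (h ▸ rfl), e, he, hve, hu⟩, rfl⟩
  · rintro ⟨u, ⟨hne, e, he, hve, hu⟩, rfl⟩
    exact ⟨fun h => hne (hinj hv (he.subset_vertexSet hu) h.symm), _, ⟨e, ⟨he, hve⟩, rfl⟩, u, hu,
      rfl⟩

end Hypergraph

/-! ### Messages -/

namespace LocalAlgorithm

variable {P Out : Type} {V : Type*} {A : LocalAlgorithm P Out} {H : Hypergraph V} {ident : V → ℕ}

theorem run_succ (p : P) (t : ℕ) (v : V) : A.run H ident p (t + 1) v =
    A.receive (A.run H ident p t v) (A.inbox H ident (A.run H ident p t) v) := rfl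

theorem inbox_of_adj (hinj : Set.InjOn ident V(H)) (σ : V → A.State) {u v : V}
    (h : H.underlyingGraph.Adj v u) :
    A.inbox H ident σ v (ident u) = some (A.send (σ u) (ident v)) := by
  have hex : ∃ u', H.underlyingGraph.Adj v u' ∧ ident u' = ident u := ⟨u, h, rfl⟩
  have hu : hex.choose = u := hinj
    (Hypergraph.underlyingGraph_adj_left_mem hex.choose_spec.1.symm)
    (Hypergraph.underlyingGraph_adj_left_mem h.symm) hex.choose_spec.2
  rw [inbox, dif_pos hex, hu]

theorem inbox_of_not_exists (σ : V → A.State) {v : V} {m : ℕ}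
    (h : ¬ ∃ u, H.underlyingGraph.Adj v u ∧ ident u = m) : A.inbox H ident σ v m = none :=
  dif_neg h

theorem inbox_eq_some_iff (hinj : Set.InjOn ident V(H)) (σ : V → A.State) {v : V} {m : ℕ}
    {x : A.Msg} : A.inbox H ident σ v m = some x ↔
      ∃ u, H.underlyingGraph.Adj v u ∧ ident u = m ∧ A.send (σ u) (ident v) = x := by
  constructor
  · intro h
    by_cases hex : ∃ u, H.underlyingGraph.Adj v u ∧ ident u = m
    · obtain ⟨u, hu, rfl⟩ := hex
      rw [inbox_of_adj hinj σ hu] at h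
      exact ⟨u, hu, rfl, Option.some.inj h⟩
    · rw [inbox_of_not_exists σ hex] at h
      exact absurd h (by simp)
  · rintro ⟨u, hu, rfl, rfl⟩
    exact inbox_of_adj hinj σ hu

end LocalAlgorithm

/-! ### The colouring subroutine -/

/-- The algorithm that performs the rounds of recolouring listed by `l`, starting from the
identifiers. -/
def recolorAlgorithm (l : ℕ × ℕ → List (ℕ → Set ℕ → ℕ)) : LocalAlgorithm (ℕ × ℕ) ℕ where
  State := List (ℕ → Set ℕ → ℕ) × ℕ
  Msg := ℕ
  init p w := (l p, w.ident)
  send s _ := s.2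
  receive s inbox := (s.1.tail, s.1.head?.elim s.2 fun f => f s.2 {x | ∃ m, inbox m = some x})
  output s := if s.1.isEmpty then some s.2 else none
  output_receive := by
    rintro ⟨_ | ⟨f, l⟩, c⟩ inbox o h <;> simp_all

theorem recolorList_take_succ {V : Type*} (G : SimpleGraph V) (l : List (ℕ → Set ℕ → ℕ))
    (φ : V → ℕ) {t : ℕ} (ht : t < l.length) :
    recolorList G (l.take (t + 1)) φ = recolor G l[t] (recolorList G (l.take t) φ) := by
  rw [recolorList, List.take_succ_eq_append_getElem ht, List.foldl_append]
  rfl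

theorem recolorAlgorithm_run {V : Type*} {H : Hypergraph V} {ident : V → ℕ}
    (hinj : Set.InjOn ident V(H)) (l : ℕ × ℕ → List (ℕ → Set ℕ → ℕ)) (p : ℕ × ℕ) (t : ℕ)
    (ht : t ≤ (l p).length) (v : V) :
    (recolorAlgorithm l).run H ident p t v =
      ((l p).drop t, recolorList H.underlyingGraph ((l p).take t) ident v) := by
  induction t generalizing v with
  | zero => rfl
  | succ t ih =>
    have ih' := ih (by omega)
    have hset : {x | ∃ m, (recolorAlgorithm l).inbox H ident
        ((recolorAlgorithm l).run H ident p t) v m = some x} =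
        recolorList H.underlyingGraph ((l p).take t) ident ''
          H.underlyingGraph.neighborSet v := by
      ext x
      simp only [LocalAlgorithm.inbox_eq_some_iff hinj, Set.mem_ofPred_eq, ih']
      constructor
      · rintro ⟨m, u, hu, -, h⟩
        exact ⟨u, hu, h⟩
      · rintro ⟨u, hu, h⟩
        exact ⟨_, u, hu, rfl, h⟩
    rw [recolorList_take_succ _ _ _ ht, LocalAlgorithm.run]
    simp only [recolorAlgorithm] at hset ih' ⊢
    rw [hset, ih']
    simp [List.head?_drop, List.getElem?_eq_getElem ht, recolor]

theorem recolorAlgorithm_computes {V : Type*} {H : Hypergraph V} {ident : V → ℕ}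
    (hinj : Set.InjOn ident V(H)) (l : ℕ × ℕ → List (ℕ → Set ℕ → ℕ)) (p : ℕ × ℕ) :
    (recolorAlgorithm l).Computes H ident p (l p).length
      (recolorList H.underlyingGraph (l p) ident) := by
  intro v _
  rw [recolorAlgorithm_run hinj l p _ le_rfl]
  simp [recolorAlgorithm]

/-! ### Greedy selection along the colour classes -/

namespace Hypergraph

variable {V : Type*} {H : Hypergraph V} {ident : V → ℕ} {Ψ : V → ℕ} {α β δ : ℕ}

/-- The vertices that have joined the independent set when the colours `1, …, t` have been
activated. -/
def joinedSet (H : Hypergraph V) (Ψ : V → ℕ) (α : ℕ) : ℕ → Set V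
  | 0 => ∅
  | t + 1 => H.joinedSet Ψ α t ∪
      {v ∈ V(H) | Ψ v = t + 1 ∧ ∀ e ∈ E(H), v ∈ e → (e ∩ H.joinedSet Ψ α t).ncard < α}

theorem joinedSet_subset (t : ℕ) : H.joinedSet Ψ α t ⊆ V(H) := by
  induction t with
  | zero => exact Set.empty_subset _
  | succ t ih => exact Set.union_subset ih fun v hv => hv.1

theorem joinedSet_mono : Monotone (H.joinedSet Ψ α) :=
  monotone_nat_of_le_succ fun _ => Set.subset_union_left

theorem color_le_of_mem_joinedSet {t : ℕ} {v : V} (hv : v ∈ H.joinedSet Ψ α t) : Ψ v ≤ t := by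
  induction t with
  | zero => exact hv.elim
  | succ t ih =>
    rcases hv with hv | hv
    · exact (ih hv).trans t.le_succ
    · exact hv.2.1.le

theorem mem_joinedSet_of_color_le {s t : ℕ} {v : V} (hv : v ∈ H.joinedSet Ψ α s)
    (ht : Ψ v ≤ t) : v ∈ H.joinedSet Ψ α t := by
  induction s with
  | zero => exact hv.elim
  | succ s ih =>
    rcases hv with hv' | hv'
    · exact ih hv'
    · have hst : s + 1 ≤ t := hv'.2.1 ▸ ht
      exact joinedSet_mono hst (.inr hv')

theorem mem_joinedSet_succ_iff {t : ℕ} {v : V} (hv : v ∈ V(H)) (hΨ : Ψ v = t + 1) :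
    v ∈ H.joinedSet Ψ α (t + 1) ↔
      ∀ e ∈ E(H), v ∈ e → (e ∩ H.joinedSet Ψ α t).ncard < α := by
  constructor
  · rintro (h | h)
    · have := color_le_of_mem_joinedSet h
      omega
    · exact h.2.2
  · exact fun h => .inr ⟨hv, hΨ, h⟩

theorem isIndependentSet_joinedSet (hV : V(H).Finite) (hαβ : α ≤ β)
    (hΨ : ∀ u v, (H.split ident (β - α + 1)).underlyingGraph.Adj u v → Ψ u ≠ Ψ v) {m : ℕ}
    (hm : ∀ v ∈ V(H), 1 ≤ Ψ v ∧ Ψ v ≤ m) :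
    H.IsIndependentSet α β (H.joinedSet Ψ α m) where
  subset := joinedSet_subset m
  le_of_edge e he := by
    have hfin := finite_of_mem_edgeSet hV he
    rcases (e ∩ H.joinedSet Ψ α m).eq_empty_or_nonempty with h0 | hne
    · simp [h0]
    -- A member `v` of largest colour `j + 1`: all other members in `e` joined earlier or share its
    -- colour.
    obtain ⟨v, ⟨hve, hvJ⟩, hmax⟩ :=
      Set.exists_max_image _ Ψ (hfin.subset Set.inter_subset_left) hne
    have hvV := joinedSet_subset m hvJ
    obtain ⟨j, hj⟩ := Nat.exists_eq_add_of_le' (hm v hvV).1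
    have h1 := (mem_joinedSet_succ_iff hvV hj).1 (mem_joinedSet_of_color_le hvJ hj.le) e he hve
    have hsub : e ∩ H.joinedSet Ψ α m ⊆ (e ∩ H.joinedSet Ψ α j) ∪ {u ∈ e | Ψ u = j + 1} := by
      intro u hu
      rcases (hmax u hu).lt_or_eq with h | h
      · exact .inl ⟨hu.1, mem_joinedSet_of_color_le hu.2 (by omega)⟩
      · exact .inr ⟨hu.1, h.trans hj⟩
    have h2 := ncard_color_class_le hV (Nat.succ_pos (β - α)) hΨ he (j + 1)
    have h3 := (Set.ncard_le_ncard hsub ((hfin.subset Set.inter_subset_left).union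
      (hfin.subset fun u hu => hu.1))).trans (Set.ncard_union_le _ _)
    omega
  mem_or v hv := by
    by_contra! h
    obtain ⟨h1, h2⟩ := h
    obtain ⟨j, hj⟩ := Nat.exists_eq_add_of_le' (hm v hv).1
    refine h1 (joinedSet_mono (hj ▸ (hm v hv).2) ((mem_joinedSet_succ_iff hv hj).2
      fun e he hve => lt_of_le_of_lt ?_ (h2 e he hve)))
    exact Set.ncard_le_ncard (Set.inter_subset_inter_right e (joinedSet_mono (by
      have := (hm v hv).2; omega)))
      ((finite_of_mem_edgeSet hV he).subset Set.inter_subset_left)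

end Hypergraph

/-! ### The execution of the algorithm -/

section Execution

variable {V : Type*} {H : Hypergraph V} {ident : V → ℕ} {col : LocalAlgorithm (ℕ × ℕ) ℕ}
  {tcol : ℕ × ℕ → ℕ} {p : ISParams} {Ψ : V → ℕ}

open Hypergraph

/-- Adjacency in the split hypergraph implies adjacency in `H`, so the subroutine's messages travel
along `H`; discarding those from other neighbours recovers the inbox of the subroutine. -/
theorem edgePartitionIS_run_coloring (hinj : Set.InjOn ident V(H)) (hr : p.r = H.rank) {t : ℕ}
    (ht : t ≤ tcol p.colorParams) {v : V} (hv : v ∈ V(H)) :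
    (edgePartitionIS col tcol).run H ident p t v =
      { params := p
        view := H.localView ident v
        clock := t
        colState := col.run (H.split ident p.δ) ident p.colorParams t v
        joined := ∅
        decision := none } := by
  classical
  induction t generalizing v with
  | zero =>
    simp only [LocalAlgorithm.run]
    rw [← localView_split hinj hv, ← hr]
    rfl
  | succ t ih =>
    have ih' : ∀ {v : V}, v ∈ V(H) → _ := fun hv => ih (by omega) hv
    have hmsg : (fun m => if m ∈ ((H.localView ident v).split p.r p.δ).neighbors then
        ((edgePartitionIS col tcol).inbox H ident
          ((edgePartitionIS col tcol).run H ident p t) v m).bind Sum.getLeft? else none) =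
        col.inbox (H.split ident p.δ) ident
          (col.run (H.split ident p.δ) ident p.colorParams t) v := by
      funext m
      have hiff := mem_neighbors_localView (H := H.split ident p.δ) hinj hv (m := m)
      rw [hr, localView_split hinj hv]
      by_cases hex : ∃ u, (H.split ident p.δ).underlyingGraph.Adj v u ∧ ident u = m
      · rw [if_pos (hiff.2 hex)]
        obtain ⟨u, hu, rfl⟩ := hex
        have hu' := adj_of_split_adj hu
        rw [LocalAlgorithm.inbox_of_adj hinj _ hu',
          LocalAlgorithm.inbox_of_adj (H := H.split ident p.δ) hinj _ hu,
          ih' (underlyingGraph_adj_left_mem hu'.symm)]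
        have hlt : t < tcol p.colorParams := ht
        simp [edgePartitionIS, hlt]
      · rw [if_neg (mt hiff.1 hex), LocalAlgorithm.inbox_of_not_exists _ hex]
    refine (LocalAlgorithm.run_succ p t v).trans ?_
    rw [ih' hv, LocalAlgorithm.run_succ, ← hmsg]
    have hlt : t < tcol p.colorParams := ht
    simp only [edgePartitionIS, hlt, if_true]

open Classical in
theorem edgePartitionIS_run_selection (hinj : Set.InjOn ident V(H)) (hr : p.r = H.rank)
    (hcol : col.Computes (H.split ident p.δ) ident p.colorParams (tcol p.colorParams) Ψ)
    (hΨ : ∀ v ∈ V(H), 1 ≤ Ψ v) (t : ℕ) {v : V} (hv : v ∈ V(H)) :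
    (edgePartitionIS col tcol).run H ident p (tcol p.colorParams + t) v =
      { params := p
        view := H.localView ident v
        clock := tcol p.colorParams + t
        colState := col.run (H.split ident p.δ) ident p.colorParams (tcol p.colorParams) v
        joined := ident '' {u | H.underlyingGraph.Adj v u ∧ u ∈ H.joinedSet Ψ p.α t}
        decision := if Ψ v ≤ t then some (decide (v ∈ H.joinedSet Ψ p.α t)) else none } := by
  induction t generalizing v with
  | zero =>
    have h1 : ¬ Ψ v ≤ 0 := by have := hΨ v hv; omega
    have h2 := edgePartitionIS_run_coloring (col := col) (tcol := tcol) hinj hr le_rfl hv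
    simpa [joinedSet, h1] using h2
  | succ t ih =>
    have hcanJoin : ∀ w ∈ V(H), Ψ w = t + 1 →
        ((∀ e ∈ (H.localView ident w).edges,
          (e ∩ ident '' {u | H.underlyingGraph.Adj w u ∧ u ∈ H.joinedSet Ψ p.α t}).ncard < p.α) ↔
        w ∈ H.joinedSet Ψ p.α (t + 1)) := by
      intro w hw hwt
      -- `joined` records neighbours only. This loses nothing, as `w` cannot be a member before its
      -- own turn.
      have hnot : w ∉ H.joinedSet Ψ p.α t := fun h => by
        have := color_le_of_mem_joinedSet h
        omega
      have hcard : ∀ e ∈ E(H), w ∈ e → (ident '' e ∩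
          ident '' {u | H.underlyingGraph.Adj w u ∧ u ∈ H.joinedSet Ψ p.α t}).ncard =
          (e ∩ H.joinedSet Ψ p.α t).ncard := by
        intro e he hwe
        rw [← (hinj.mono (Set.inter_subset_left.trans he.subset_vertexSet) :
          Set.InjOn ident (e ∩ H.joinedSet Ψ p.α t)).ncard_image]
        congr 1
        ext m
        constructor
        · rintro ⟨⟨x, hx, rfl⟩, u, hu, hux⟩
          have := hinj (joinedSet_subset t hu.2) (he.subset_vertexSet hx) hux
          exact ⟨x, ⟨hx, this ▸ hu.2⟩, rfl⟩
        · rintro ⟨x, ⟨hx, hxJ⟩, rfl⟩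
          exact ⟨⟨x, hx, rfl⟩, x, ⟨⟨fun h => hnot (h ▸ hxJ), e, he, hwe, hx⟩, hxJ⟩, rfl⟩
      rw [mem_joinedSet_succ_iff hw hwt]
      constructor
      · intro h e he hwe
        rw [← hcard e he hwe]
        exact h _ ⟨e, ⟨he, hwe⟩, rfl⟩
      · rintro h _ ⟨e, ⟨he, hwe⟩, rfl⟩
        rw [hcard e he hwe]
        exact h e he hwe
    have hactive : ∀ w ∈ V(H), (col.output (col.run (H.split ident p.δ) ident p.colorParams
        (tcol p.colorParams) w) = some (t + 1) ↔ Ψ w = t + 1) := by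
      intro w hw
      rw [hcol w hw, Option.some_inj]
    have hjoin : {m | (edgePartitionIS col tcol).inbox H ident
        ((edgePartitionIS col tcol).run H ident p (tcol p.colorParams + t)) v m =
          some (Sum.inr true)} =
        ident '' {u | H.underlyingGraph.Adj v u ∧ u ∈ V(H) ∧ Ψ u = t + 1 ∧
          u ∈ H.joinedSet Ψ p.α (t + 1)} := by
      ext m
      refine (LocalAlgorithm.inbox_eq_some_iff hinj _).trans ?_
      have hsend : ∀ u ∈ V(H), (edgePartitionIS col tcol).send
          ((edgePartitionIS col tcol).run H ident p (tcol p.colorParams + t) u) (ident v) =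
          Sum.inr true ↔ Ψ u = t + 1 ∧ u ∈ H.joinedSet Ψ p.α (t + 1) := by
        intro u hu
        rw [ih hu, ← hactive u hu]
        simp only [edgePartitionIS, Nat.not_lt.2 (Nat.le_add_right _ t), if_false,
          Sum.inr.injEq, decide_eq_true_eq, Nat.add_sub_cancel_left]
        exact and_congr_right fun h => hcanJoin u hu ((hactive u hu).1 h)
      constructor
      · rintro ⟨u, hu, rfl, h⟩
        have huV := underlyingGraph_adj_left_mem hu.symm
        exact ⟨u, ⟨hu, huV, (hsend u huV).1 h⟩, rfl⟩
      · rintro ⟨u, ⟨hu, huV, h⟩, rfl⟩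
        exact ⟨u, hu, rfl, (hsend u huV).2 h⟩
    have hjoined : ident '' {u | H.underlyingGraph.Adj v u ∧ u ∈ H.joinedSet Ψ p.α t} ∪
        ident '' {u | H.underlyingGraph.Adj v u ∧ u ∈ V(H) ∧ Ψ u = t + 1 ∧
          u ∈ H.joinedSet Ψ p.α (t + 1)} =
        ident '' {u | H.underlyingGraph.Adj v u ∧ u ∈ H.joinedSet Ψ p.α (t + 1)} := by
      rw [← Set.image_union]
      congr 1
      ext u
      constructor
      · rintro (⟨h1, h2⟩ | ⟨h1, -, -, h2⟩)
        · exact ⟨h1, joinedSet_mono t.le_succ h2⟩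
        · exact ⟨h1, h2⟩
      · rintro ⟨h1, h2⟩
        rcases h2 with h | h
        · exact .inl ⟨h1, h⟩
        · exact .inr ⟨h1, h.1, h.2.1, .inr h⟩
    refine (LocalAlgorithm.run_succ p (tcol p.colorParams + t) v).trans ?_
    rw [← hjoined, ← hjoin, ih hv]
    simp only [edgePartitionIS, Nat.not_lt.2 (Nat.le_add_right _ t), if_false,
      Nat.add_sub_cancel_left, ISState.mk.injEq, true_and]
    refine ⟨rfl, ?_⟩
    rcases lt_trichotomy (Ψ v) (t + 1) with h | h | h
    · rw [if_pos (Nat.lt_succ_iff.1 h), if_pos h.le, Option.some_or, Option.some_inj,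
        decide_eq_decide]
      exact ⟨fun hJ => joinedSet_mono t.le_succ hJ,
        fun hJ => mem_joinedSet_of_color_le hJ (Nat.lt_succ_iff.1 h)⟩
    · rw [if_neg (by omega), if_pos h.le, Option.none_or, if_pos ((hactive v hv).2 h),
        Option.some_inj, decide_eq_decide]
      exact hcanJoin v hv h
    · rw [if_neg (by omega), Option.none_or, if_neg (fun h' => h.ne' ((hactive v hv).1 h')),
        if_neg (by omega)]

end Execution

/-! ### The subroutine and the final bound -/

theorem exists_coloring_subroutine (c : ℕ) :
    ∃ (col : LocalAlgorithm (ℕ × ℕ) ℕ) (tcol : ℕ × ℕ → ℕ) (A : ℕ),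
      (∀ n k, 1 ≤ k → tcol (n, k) ≤ A * (k + logStar n)) ∧
      ∀ {V : Type u} (H : Hypergraph V) (ident : V → ℕ) (n k : ℕ), 1 ≤ k →
        Set.InjOn ident V(H) → (∀ v ∈ V(H), ident v ≤ n ^ c) →
        DegreeBound H.underlyingGraph V(H) k →
        ∃ Ψ : V → ℕ, col.Computes H ident (n, k) (tcol (n, k)) Ψ ∧
          (∀ v ∈ V(H), 1 ≤ Ψ v ∧ Ψ v ≤ k + 1) ∧
          ∀ u v, H.underlyingGraph.Adj u v → Ψ u ≠ Ψ v := by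
  obtain ⟨A, hA⟩ := exists_reduces.{u} c
  have hl : ∀ p : ℕ × ℕ, ∃ l : List (ℕ → Set ℕ → ℕ), 1 ≤ p.2 →
      l.length ≤ A * (p.2 + logStar p.1) ∧
      ∀ (V : Type u) (G : SimpleGraph V) (W : Set V), DegreeBound G W p.2 →
        ∀ φ : V → ℕ, IsProperOn G W (Set.Iic (p.1 ^ c)) φ →
          IsProperOn G W (Set.Icc 1 (p.2 + 1)) (recolorList G l φ) := by
    intro p
    by_cases hp : 1 ≤ p.2
    · obtain ⟨T, hT, l, rfl, h⟩ := hA p.1 p.2 hp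
      exact ⟨l, fun _ => ⟨hT, h⟩⟩
    -- A default for `k = 0`, which never occurs: `δ ≤ r` forces an edge, hence `Δ ≥ 1` and `k ≥ 1`.
    · exact ⟨[], fun h => absurd h hp⟩
  choose l hl using hl
  refine ⟨recolorAlgorithm l, fun p => (l p).length, A, fun n k hk => (hl (n, k) hk).1, ?_⟩
  intro V H ident n k hk hinj hident hdeg
  have := (hl (n, k) hk).2 V H.underlyingGraph V(H) hdeg ident
    ⟨hident, fun u v huv h => huv.1 (hinj (Hypergraph.underlyingGraph_adj_left_mem huv)
      (Hypergraph.underlyingGraph_adj_left_mem huv.symm) h)⟩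
  exact ⟨_, recolorAlgorithm_computes hinj l (n, k), this.mem, this.ne⟩

end

theorem mainTheorem2 (c : ℕ) :
    ∃ (col : LocalAlgorithm (ℕ × ℕ) ℕ) (tcol : ℕ × ℕ → ℕ) (C : ℝ),
      ∀ {V : Type*} (H : Hypergraph V) (ident : V → ℕ) (n Δ r α β δ k : ℕ),
        H.vertexSet.Finite → H.vertexSet.ncard = n → H.maxDegree = Δ → H.rank = r →
        Set.InjOn ident H.vertexSet → (∀ v ∈ H.vertexSet, ident v ≤ n ^ c) →
        α ≤ β → δ = β - α + 1 → δ ≤ r → k = Δ * r / δ →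
        -- the subroutine properly colours the underlying graph of the split hypergraph
        (∃ Ψ : V → ℕ, col.Computes (H.split ident δ) ident (n, k) (tcol (n, k)) Ψ ∧
          (∀ v ∈ H.vertexSet, 1 ≤ Ψ v ∧ Ψ v ≤ k + 1) ∧
          ∀ u v, (H.split ident δ).underlyingGraph.Adj u v → Ψ u ≠ Ψ v) ∧
        -- with this subroutine, the algorithm finds an independent set within the claimed time
        ∃ (T : ℕ) (o : V → Bool),
          (T : ℝ) ≤ C * ((Δ : ℝ) * r / δ + logStar n) ∧
          (edgePartitionIS col tcol).Computes H ident ⟨n, Δ, r, α, β⟩ T o ∧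
          H.IsIndependentSet α β {v ∈ H.vertexSet | o v = true} := by
  classical
  obtain ⟨col, tcol, A, hA, hcol⟩ := exists_coloring_subroutine c
  refine ⟨col, tcol, A + 2, ?_⟩
  intro V H ident n Δ r α β δ k hV hn hΔ hr hinj hident hαβ hδ hδr hk
  have hδpos : 0 < δ := by omega
  have hΔpos : 1 ≤ Δ := hΔ ▸ H.one_le_maxDegree hV (by omega)
  have hk1 : 1 ≤ k := by
    rw [hk, Nat.le_div_iff_mul_le hδpos, one_mul]
    exact hδr.trans (Nat.le_mul_of_pos_left r hΔpos)
  have hdeg := H.split_degreeBound (ident := ident) (δ := δ) hV hinj hδpos (hr ▸ hδr)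
  rw [hΔ, hr, ← hk] at hdeg
  obtain ⟨Ψ, hΨ, hΨmem, hΨne⟩ := hcol (H.split ident δ) ident n k hk1 hinj hident hdeg
  refine ⟨⟨Ψ, hΨ, hΨmem, hΨne⟩, tcol (n, k) + (k + 1),
    fun v => decide (v ∈ H.joinedSet Ψ α (k + 1)), ?_, ?_, ?_⟩
  -- The `k + 1` selection rounds cost at most `2 * k`, since `k ≥ 1`.
  · have h1 : tcol (n, k) + (k + 1) ≤ (A + 2) * (k + logStar n) := by
      have := hA n k hk1
      nlinarith
    have h2 : (k : ℝ) ≤ (Δ : ℝ) * r / δ := by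
      rw [hk]
      exact_mod_cast Nat.cast_div_le (α := ℝ) (m := Δ * r) (n := δ)
    calc ((tcol (n, k) + (k + 1) : ℕ) : ℝ) ≤ ((A + 2) * (k + logStar n) : ℕ) := by
          exact_mod_cast h1
      _ = (A + 2) * ((k : ℝ) + logStar n) := by push_cast; ring
      _ ≤ _ := by gcongr
  · intro v hv
    have hp : (⟨n, Δ, r, α, β⟩ : ISParams).colorParams = (n, k) := by
      simp [ISParams.colorParams, ISParams.δ, hk, hδ]
    have hp' : (⟨n, Δ, r, α, β⟩ : ISParams).δ = δ := hδ.symm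
    have := edgePartitionIS_run_selection (p := ⟨n, Δ, r, α, β⟩) (col := col) (tcol := tcol)
      hinj hr.symm (by rw [hp, hp']; exact hΨ) (fun v hv => (hΨmem v hv).1) (k + 1) hv
    rw [hp] at this
    rw [this]
    exact if_pos (hΨmem v hv).2
  · have hset : {v ∈ H.vertexSet | decide (v ∈ H.joinedSet Ψ α (k + 1)) = true} =
        H.joinedSet Ψ α (k + 1) := by
      ext v
      simp only [Set.mem_ofPred_eq, decide_eq_true_eq]
      exact ⟨fun h => h.2, fun h => ⟨H.joinedSet_subset _ h, h⟩⟩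
    rw [hset]
    exact H.isIndependentSet_joinedSet hV hαβ (hδ ▸ hΨne) hΨmem
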